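/- Let $K$ be a finite field of odd characteristic, let $f\in K[X]$ be a square-free polynomial of degree at least $5$, and let $F=K(x,y)$ with $x$ transcendental over $K$ and $y^2=f(x)$ be the function field of the hyperelliptic curve $y^2=f(x)$. A place of $F/K$ is the maximal ideal of a valuation ring $\mathcal O$ of $F$ with $K\subsetneq\mathcal O\subsetneq F$; it is called rational if its residue field has degree $1$ over $K$. Let $\sigma$ be the hyperelliptic conjugation, i.e. the automorphism of $F$ over $K$ with $\sigma(x)=x$ and $\sigma(y)=-y$, which also acts on the places of $F/K$. Let $P_1,\dots,P_n$ be distinct rational places of $F/K$ that are not poles of $x$ and satisfy $\sigma P_i\neq P_j$ for all $i,j\in\{1,\dots,n\}$ (so that $P_i$ and $\sigma P_i$ are the two places over one rational place of $K(x)$), and let $\alpha_i=x(P_i)\in K$ be the $x$-coordinate of the point of the curve corresponding to $P_i$. Consider the differential $$\eta=\frac{1}{y\,\prod_{j=1}^{n}(x-\alpha_j)}\,dx$$ of $F/K$. At a rational place $P$ the residue of a differential $\omega$ is defined as follows: for a prime element $t$ of $P$ write $\omega=z\,dt$ with $z\in F$ and expand $z=\sum_{i\ge m}a_it^i$ with $a_i\in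 K$ in the $P$-adic completion; then $\operatorname{res}_P\omega=a_{-1}$. Then for every $i=1,\dots,n$ the residues of $\eta$ at $P_i$ and at $\sigma P_i$ are well defined (they exist and do not depend on the prime element), and $$\operatorname{res}_{P_i}\eta=-\operatorname{res}_{\sigma P_i}\eta .$$ -/

import Mathlib

namespace HyperellipticResidue

open Polynomial IntermediateField

section FunctionField

variable {K F : Type*} [Field K] [Field F] [Algebra K F]

/-- `F = K(x, y)` with `x` transcendental over `K` and `y ^ 2 = f(x)`, where `f` is a square-free
polynomial of degree at least `5`: the function field of a hyperelliptic curve `y ^ 2 = f(x)`. -/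
structure IsHyperelliptic (f : K[X]) (x y : F) : Prop where
  squarefree : Squarefree f
  five_le_natDegree : 5 ≤ f.natDegree
  transcendental : Transcendental K x
  sq_eq : y ^ 2 = aeval x f
  adjoin_eq_top : IntermediateField.adjoin K {x, y} = ⊤

theorem IsHyperelliptic.sq_ne {f : K[X]} {x y : F} (h : IsHyperelliptic f x y)
    (b : K⟮x⟯) : b ^ 2 ≠ aeval (AdjoinSimple.gen K x) f := by
  intro hb
  let e := RatFunc.algEquivOfTranscendental x h.transcendental
  have h1 : (e.symm b) ^ 2 = algebraMap K[X] (RatFunc K) f := by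
    rw [← map_pow, hb]
    exact RatFunc.algEquivOfTranscendental_symm_aeval x h.transcendental f
  have h2 : IsIntegral K[X] ((e.symm b) ^ 2) := h1 ▸ isIntegral_algebraMap
  obtain ⟨g, hg⟩ := IsIntegrallyClosed.exists_algebraMap_eq_of_isIntegral_pow two_pos h2
  rw [← hg, ← map_pow] at h1
  have h3 : g ^ 2 = f := IsFractionRing.injective K[X] (RatFunc K) h1
  have h4 : IsUnit g := h.squarefree g ⟨1, by rw [← h3]; ring⟩
  have h5 : f.natDegree = 0 := by
    rw [← h3]; exact natDegree_eq_zero_of_isUnit (h4.pow 2)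
  have := h.five_le_natDegree
  omega

/-- Adjoining a square root `y` of a non-square: the automorphism with `y ↦ -y` exists. -/
theorem exists_algEquiv_neg {E : Type*} [Field E] [Algebra E F] {a : E} {y : F}
    (haF : algebraMap E F a = y ^ 2) (hne : ∀ b : E, b ^ 2 ≠ a)
    (hgen : IntermediateField.adjoin E {y} = ⊤) :
    ∃ σ : F ≃ₐ[E] F, σ y = -y := by
  set q : E[X] := X ^ 2 - C a with hq
  have hirr : Irreducible q := X_pow_sub_C_irreducible_of_prime Nat.prime_two hne
  have hmonic : q.Monic := monic_X_pow_sub_C a two_ne_zero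
  have hroot : aeval y q = 0 := by simp [hq, haF]
  have hroot' : aeval (-y) q = 0 := by simp [hq, haF]
  have hmin : minpoly E y = q := (minpoly.eq_of_irreducible_of_monic hirr hroot hmonic).symm
  have hsplit : (q.map (algebraMap E F)).Splits := by
    have : q.map (algebraMap E F) = (X - C y) * (X - C (-y)) := by
      simp only [hq, Polynomial.map_sub, Polynomial.map_pow, map_X, map_C, haF, map_pow, map_neg]
      ring
    rw [this]
    exact (Splits.X_sub_C y).mul (Splits.X_sub_C (-y))
  have hint : IsIntegral E y := ⟨q, hmonic, hroot⟩
  have hnormal : Normal E F := by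
    have : q.IsSplittingField E F := by
      refine isSplittingField_iff_intermediateField.2 ⟨hsplit, ?_⟩
      rw [eq_top_iff, ← hgen]
      refine IntermediateField.adjoin.mono _ _ _ ?_
      rintro z rfl
      exact (mem_rootSet_of_ne hmonic.ne_zero).2 hroot
    exact Normal.of_isSplittingField q
  exact minpoly.exists_algEquiv_of_root' (K := E) (x := -y) (y := y) hint.isAlgebraic
    (by rw [hmin]; exact hroot')

/-- The automorphism of `K(x, y)` over `K(x)` with `y ↦ -y` exists. -/
theorem IsHyperelliptic.exists_conj {f : K[X]} {x y : F} (h : IsHyperelliptic f x y) :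
    ∃ σ : F ≃ₐ[K] F, σ x = x ∧ σ y = -y := by
  have haF : algebraMap K⟮x⟯ F (aeval (AdjoinSimple.gen K x) f) = y ^ 2 := by
    rw [h.sq_eq, ← aeval_algebraMap_apply, AdjoinSimple.algebraMap_gen]
  have hgen : IntermediateField.adjoin K⟮x⟯ {y} = ⊤ := by
    apply IntermediateField.restrictScalars_injective K
    rw [adjoin_simple_adjoin_simple, h.adjoin_eq_top, IntermediateField.restrictScalars_top]
  obtain ⟨σ, hσ⟩ := exists_algEquiv_neg haF h.sq_ne hgen
  exact ⟨σ.restrictScalars K, by simpa using σ.commutes (AdjoinSimple.gen K x), hσ⟩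

/-- The hyperelliptic conjugation of `K(x, y)`: the automorphism over `K` with `x ↦ x` and
`y ↦ -y` (these two values determine it, since `x` and `y` generate the field). -/
noncomputable def IsHyperelliptic.conj {f : K[X]} {x y : F} (h : IsHyperelliptic f x y) :
    F ≃ₐ[K] F :=
  h.exists_conj.choose

theorem IsHyperelliptic.conj_x {f : K[X]} {x y : F} (h : IsHyperelliptic f x y) :
    h.conj x = x :=
  h.exists_conj.choose_spec.1

theorem IsHyperelliptic.conj_y {f : K[X]} {x y : F} (h : IsHyperelliptic f x y) :
    h.conj y = -y :=
  h.exists_conj.choose_spec.2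

end FunctionField

/-- A place of the function field `F / K`, given by its valuation ring `O` with `K ⊊ O ⊊ F`;
the place itself, as an ideal, is the maximal ideal of `O`. (A valuation ring of `F` that is a
field is all of `F`, so `O ≠ K` follows from `O ≠ F`.) -/
@[ext]
structure Place (K F : Type*) [Field K] [Field F] [Algebra K F] where
  ring : ValuationSubring F
  algebraMap_mem : ∀ c : K, algebraMap K F c ∈ ring
  ne_top : ring ≠ ⊤

namespace Place

variable {K F : Type*} [Field K] [Field F] [Algebra K F]

/-- The structure of a `K`-algebra on the valuation ring of a place. -/
instance instAlgebraRing (P : Place K F) : Algebra K P.ring :=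
  ((algebraMap K F).codRestrict P.ring P.algebraMap_mem).toAlgebra

/-- The degree `[O / P : K]` of a place. -/
noncomputable def degree (P : Place K F) : ℕ :=
  Module.finrank K (IsLocalRing.ResidueField P.ring)

/-- A place is rational if it has degree one. -/
def IsRational (P : Place K F) : Prop :=
  P.degree = 1

/-- `z` is regular at `P`, and its residue class `z(P)` is the constant `c`. -/
def HasValue (P : Place K F) (z : F) (c : K) : Prop :=
  ∃ hz : z ∈ P.ring,
    IsLocalRing.residue P.ring ⟨z, hz⟩ = algebraMap K (IsLocalRing.ResidueField P.ring) c

/-- `t` is a prime element of `P`: it generates the maximal ideal of the valuation ring. -/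
def IsPrimeElement (P : Place K F) (t : F) : Prop :=
  ∃ ht : t ∈ P.ring, Ideal.span {(⟨t, ht⟩ : P.ring)} = IsLocalRing.maximalIdeal P.ring

/-- The image `σP` of a place `P` under an automorphism `σ` of `F / K`; its valuation ring is
`σ(O) = {z | σ⁻¹ z ∈ O}`. -/
def map (σ : F ≃ₐ[K] F) (P : Place K F) : Place K F where
  ring := P.ring.comap (σ.symm : F →+* F)
  algebraMap_mem c := by
    rw [ValuationSubring.mem_comap]
    simpa using P.algebraMap_mem c
  ne_top h := P.ne_top <| by
    rw [eq_top_iff]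
    intro z _
    have hz : σ z ∈ P.ring.comap (σ.symm : F →+* F) := h ▸ ValuationSubring.mem_top _
    rw [ValuationSubring.mem_comap] at hz
    simpa using hz

/-- `z = ∑_{i ≥ n} a i * t ^ i` is the `P`-adic power series expansion of `z` with respect to the
prime element `t`: every partial sum over `i < N` differs from `z` by an element of `t ^ N * O`. -/
def IsExpansion (P : Place K F) (t z : F) (a : ℤ → K) : Prop :=
  ∃ n : ℤ, (∀ i < n, a i = 0) ∧
    ∀ N : ℤ, (z - ∑ i ∈ Finset.Ico n N, algebraMap K F (a i) * t ^ i) * t ^ (-N) ∈ P.ring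

/-- `r` is the residue of the differential `ω` at `P`: for every prime element `t` of `P`, one
can write `ω = z dt`, and `r` is the coefficient of `t ^ (-1)` in the `P`-adic expansion of `z`
with respect to `t`. -/
def HasResidue (P : Place K F) (ω : Ω[F⁄K]) (r : K) : Prop :=
  ∀ t : F, P.IsPrimeElement t →
    ∃ z : F, ω = z • KaehlerDifferential.D K F t ∧ ∃ a : ℤ → K, P.IsExpansion t z a ∧ a (-1) = r

open Classical in
/-- The residue of the differential `ω` at the place `P` (and `0` if there is none). -/
noncomputable def residue (P : Place K F) (ω : Ω[F⁄K]) : K :=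
  if h : ∃ r, P.HasResidue ω r then h.choose else 0

end Place

/-- The differential `dx / (y * ∏ i, (x - α i))`. -/
noncomputable def eta {K F : Type*} [Field K] [Field F] [Algebra K F] {n : ℕ} (x y : F)
    (α : Fin n → K) : Ω[F⁄K] :=
  (1 / (y * ∏ i, (x - algebraMap K F (α i)))) • KaehlerDifferential.D K F x

end HyperellipticResidue

namespace HyperellipticResidue

open Polynomial

/-! ### Values of functions at a place. -/

namespace Place

variable {K F : Type*} [Field K] [Field F] [Algebra K F] {P : Place K F} {z w : F} {c d : K}

/-! Let `β` be the value of `y` at `P i`. If `β ≠ 0` and the `α j` are distinct, then `t = x - α i`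
is a prime element and `η` has a simple pole with residue `1 / (β * ∏ j ≠ i, (α i - α j))`. At the
conjugate place `x` keeps its value and `y` takes the value `-β`, so the same formula gives the
opposite residue (`residue_eta`). Both conditions follow because a place is determined by its
coordinates (`place_eq`): `β = 0` would make `P i` self-conjugate, and `α i = α j` with `i ≠ j`
would make `P i` and `P j` equal or conjugate.

The algebra rests on one factorization: every nonzero function is a power of an explicit parameter
(`x - α` if `β ≠ 0`, `y` if `β = 0`) times a unit at the place. The unit can be taken in any
subalgebra `A` containing `x` and `y` and closed under inverting units at the place, so such an `A`
contains the valuation ring (`mem_of_isInvClosed`). Different choices of `A` show that coordinates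
determine the place and that `d/dx` preserves the valuation ring when `β ≠ 0`. The latter makes the
residue at a simple pole independent of the prime element (`hasResidue_of_simple_pole`); it is
unique because expansions are unique and `dx ≠ 0`. -/

theorem HasValue.mem (h : P.HasValue z c) : z ∈ P.ring := h.1

theorem hasValue_algebraMap (P : Place K F) (c : K) : P.HasValue (algebraMap K F c) c :=
  ⟨P.algebraMap_mem c, rfl⟩

theorem hasValue_one (P : Place K F) : P.HasValue 1 1 := by
  simpa using P.hasValue_algebraMap 1

theorem hasValue_zero (P : Place K F) : P.HasValue 0 0 := by
  simpa using P.hasValue_algebraMap 0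

theorem HasValue.add (hz : P.HasValue z c) (hw : P.HasValue w d) :
    P.HasValue (z + w) (c + d) := by
  obtain ⟨hz, h⟩ := hz
  obtain ⟨hw, h'⟩ := hw
  refine ⟨add_mem hz hw, ?_⟩
  rw [map_add, ← h, ← h', ← map_add]
  rfl

theorem HasValue.mul (hz : P.HasValue z c) (hw : P.HasValue w d) :
    P.HasValue (z * w) (c * d) := by
  obtain ⟨hz, h⟩ := hz
  obtain ⟨hw, h'⟩ := hw
  refine ⟨mul_mem hz hw, ?_⟩
  rw [map_mul, ← h, ← h', ← map_mul]
  rfl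

theorem HasValue.neg (hz : P.HasValue z c) : P.HasValue (-z) (-c) := by
  simpa using (P.hasValue_algebraMap (-1)).mul hz

theorem HasValue.sub (hz : P.HasValue z c) (hw : P.HasValue w d) :
    P.HasValue (z - w) (c - d) := by
  simpa [sub_eq_add_neg] using hz.add hw.neg

theorem HasValue.pow (hz : P.HasValue z c) (k : ℕ) : P.HasValue (z ^ k) (c ^ k) := by
  induction k with
  | zero => simpa using P.hasValue_one
  | succ k ih => simpa [pow_succ] using ih.mul hz

theorem HasValue.aeval (hz : P.HasValue z c) (p : K[X]) :
    P.HasValue (aeval z p) (p.eval c) := by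
  induction p using Polynomial.induction_on' with
  | add p q hp hq => simpa using hp.add hq
  | monomial k a => simpa [aeval_monomial] using (P.hasValue_algebraMap a).mul (hz.pow k)

theorem HasValue.prod {ι : Type*} (s : Finset ι) {z : ι → F} {c : ι → K}
    (h : ∀ i ∈ s, P.HasValue (z i) (c i)) : P.HasValue (∏ i ∈ s, z i) (∏ i ∈ s, c i) := by
  classical
  induction s using Finset.induction_on with
  | empty => simpa using P.hasValue_one
  | insert a s ha ih =>
    rw [Finset.prod_insert ha, Finset.prod_insert ha]
    exact (h a (Finset.mem_insert_self a s)).mul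
      (ih fun i hi => h i (Finset.mem_insert_of_mem hi))

theorem HasValue.unique (h : P.HasValue z c) (h' : P.HasValue z d) : c = d := by
  obtain ⟨_, h⟩ := h
  obtain ⟨_, h'⟩ := h'
  exact (algebraMap K (IsLocalRing.ResidueField P.ring)).injective (h.symm.trans h')

theorem HasValue.ne_zero (h : P.HasValue z c) (hc : c ≠ 0) : z ≠ 0 := by
  rintro rfl
  exact hc (h.unique P.hasValue_zero)

theorem hasValue_zero_iff (hz : z ∈ P.ring) :
    P.HasValue z 0 ↔ (⟨z, hz⟩ : P.ring) ∈ IsLocalRing.maximalIdeal P.ring := by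
  rw [← IsLocalRing.residue_eq_zero_iff]
  refine ⟨fun h => ?_, fun h => ⟨hz, by rw [h, map_zero]⟩⟩
  obtain ⟨_, h⟩ := h
  rw [h, map_zero]

theorem HasValue.inv_mem (h : P.HasValue z c) (hc : c ≠ 0) : z⁻¹ ∈ P.ring := by
  have hu : IsUnit (⟨z, h.1⟩ : P.ring) := by
    by_contra hu
    exact hc (h.unique ((hasValue_zero_iff h.1).2 ((IsLocalRing.mem_maximalIdeal _).2 hu)))
  obtain ⟨v, hv⟩ := isUnit_iff_exists_inv.1 hu
  have hv' : z * (v : F) = 1 := congrArg Subtype.val hv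
  rw [inv_eq_of_mul_eq_one_right hv']
  exact v.2

theorem HasValue.inv (h : P.HasValue z c) (hc : c ≠ 0) : P.HasValue z⁻¹ c⁻¹ := by
  have hm := h.inv_mem hc
  refine ⟨hm, ?_⟩
  obtain ⟨hz, h1⟩ := h
  have hz0 : z ≠ 0 := HasValue.ne_zero ⟨hz, h1⟩ hc
  rw [map_inv₀, ← h1]
  refine eq_inv_of_mul_eq_one_left ?_
  rw [← map_mul, ← map_one (IsLocalRing.residue P.ring)]
  congr 1
  exact Subtype.ext (inv_mul_cancel₀ hz0)

theorem HasValue.inv_not_mem (h : P.HasValue z 0) (hz : z ≠ 0) : z⁻¹ ∉ P.ring := by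
  intro hm
  have h1 := (hasValue_zero_iff h.1).1 h
  rw [IsLocalRing.mem_maximalIdeal] at h1
  exact h1 (isUnit_iff_exists_inv.2 ⟨⟨z⁻¹, hm⟩, Subtype.ext (mul_inv_cancel₀ hz)⟩)

theorem IsRational.exists_hasValue (h : P.IsRational) (hz : z ∈ P.ring) :
    ∃ c, P.HasValue z c := by
  obtain ⟨c, hc⟩ := (finrank_eq_one_iff_of_nonzero' (K := K)
    (1 : IsLocalRing.ResidueField P.ring) one_ne_zero).1 h (IsLocalRing.residue P.ring ⟨z, hz⟩)
  exact ⟨c, hz, by rw [← hc, Algebra.algebraMap_eq_smul_one]⟩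

theorem mem_map {σ : F ≃ₐ[K] F} : z ∈ (P.map σ).ring ↔ σ.symm z ∈ P.ring := Iff.rfl

theorem map_ring_symm_apply_mem {σ : F ≃ₐ[K] F} : σ z ∈ (P.map σ).ring ↔ z ∈ P.ring := by
  rw [mem_map, AlgEquiv.symm_apply_apply]

theorem HasValue.map (h : P.HasValue z c) (σ : F ≃ₐ[K] F) : (P.map σ).HasValue (σ z) c := by
  have h0 : P.HasValue (z - algebraMap K F c) 0 := by
    simpa using h.sub (P.hasValue_algebraMap c)
  have h1 : (P.map σ).HasValue (σ (z - algebraMap K F c)) 0 := by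
    have hm := map_ring_symm_apply_mem (σ := σ).2 h0.mem
    rw [hasValue_zero_iff hm, IsLocalRing.mem_maximalIdeal]
    intro hu
    obtain ⟨v, hv⟩ := isUnit_iff_exists_inv.1 hu
    have hv' : σ (z - algebraMap K F c) * (v : F) = 1 := congrArg Subtype.val hv
    have hne : z - algebraMap K F c ≠ 0 := by
      rintro h
      rw [h, map_zero, zero_mul] at hv'
      exact zero_ne_one hv'
    -- If the image under `σ` were a unit, its inverse would pull back to an inverse of `z - c` in
    -- `P.ring`.
    apply h0.inv_not_mem hne
    rw [← map_ring_symm_apply_mem (σ := σ), map_inv₀, inv_eq_of_mul_eq_one_right hv']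
    exact v.2
  simpa using h1.add ((P.map σ).hasValue_algebraMap c)

end Place

/-! ### Normal form of the elements of `K(x, y)`. -/

namespace IsHyperelliptic

variable {K F : Type*} [Field K] [Field F] [Algebra K F] {f : K[X]} {x y : F}

theorem aeval_ne_zero (h : IsHyperelliptic f x y) {r : K[X]} (hr : r ≠ 0) : aeval x r ≠ 0 :=
  fun h0 => hr (transcendental_iff.1 h.transcendental _ h0)

theorem conj_aeval (h : IsHyperelliptic f x y) (p : K[X]) : h.conj (aeval x p) = aeval x p := by
  rw [← AlgEquiv.coe_toAlgHom, ← aeval_algHom_apply, AlgEquiv.coe_toAlgHom, h.conj_x]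

theorem conj_aeval_add (h : IsHyperelliptic f x y) (p q : K[X]) :
    h.conj (aeval x p + aeval x q * y) = aeval x p - aeval x q * y := by
  rw [map_add, map_mul, h.conj_aeval, h.conj_aeval, h.conj_y]
  ring

theorem aeval_norm (h : IsHyperelliptic f x y) (p q : K[X]) :
    aeval x (p ^ 2 - q ^ 2 * f) = (aeval x p + aeval x q * y) * (aeval x p - aeval x q * y) := by
  simp only [map_sub, map_mul, map_pow, ← h.sq_eq]
  ring

theorem norm_ne_zero (h : IsHyperelliptic f x y) {p q : K[X]}
    (h0 : aeval x p + aeval x q * y ≠ 0) : p ^ 2 - q ^ 2 * f ≠ 0 := by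
  intro h3
  have h2 := h.aeval_norm p q
  rw [h3, map_zero, ← h.conj_aeval_add] at h2
  exact mul_ne_zero h0 ((_root_.map_ne_zero _).2 h0) h2.symm

/-- Every element of `K(x, y)` can be written as `(p(x) + q(x) y) / r(x)`. -/
theorem exists_eq_div (h : IsHyperelliptic f x y) (z : F) :
    ∃ p q r : K[X], r ≠ 0 ∧ z = (aeval x p + aeval x q * y) / aeval x r := by
  have hz : z ∈ IntermediateField.adjoin K {x, y} := by
    rw [h.adjoin_eq_top]; trivial
  induction hz using IntermediateField.adjoin_induction with
  | mem z hz =>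
    rcases hz with rfl | rfl
    · exact ⟨X, 0, 1, one_ne_zero, by simp⟩
    · exact ⟨0, 1, 1, one_ne_zero, by simp⟩
  | algebraMap c => exact ⟨C c, 0, 1, one_ne_zero, by simp⟩
  | add z w _ _ hz hw =>
    obtain ⟨p, q, r, hr, rfl⟩ := hz
    obtain ⟨p', q', r', hr', rfl⟩ := hw
    refine ⟨p * r' + p' * r, q * r' + q' * r, r * r', mul_ne_zero hr hr', ?_⟩
    have := h.aeval_ne_zero hr
    have := h.aeval_ne_zero hr'
    simp only [map_add, map_mul]
    field_simp
    ring
  | mul z w _ _ hz hw =>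
    obtain ⟨p, q, r, hr, rfl⟩ := hz
    obtain ⟨p', q', r', hr', rfl⟩ := hw
    refine ⟨p * p' + q * q' * f, p * q' + p' * q, r * r', mul_ne_zero hr hr', ?_⟩
    have := h.aeval_ne_zero hr
    have := h.aeval_ne_zero hr'
    simp only [map_add, map_mul, ← h.sq_eq]
    field_simp
    ring
  | inv z _ hz =>
    obtain ⟨p, q, r, hr, rfl⟩ := hz
    by_cases h0 : aeval x p + aeval x q * y = 0
    · exact ⟨0, 0, 1, one_ne_zero, by simp [h0]⟩
    have h1 : aeval x p - aeval x q * y ≠ 0 := by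
      rw [← h.conj_aeval_add]
      exact (_root_.map_ne_zero _).2 h0
    -- Rationalize the denominator: multiply by the conjugate `p - q y`.
    refine ⟨r * p, -(r * q), p ^ 2 - q ^ 2 * f, h.norm_ne_zero h0, ?_⟩
    rw [h.aeval_norm]
    have := h.aeval_ne_zero hr
    simp only [map_neg, map_mul]
    field_simp
    ring

end IsHyperelliptic

/-! ### Factorization into a power of a parameter and a unit. -/

namespace Place

variable {K F : Type*} [Field K] [Field F] [Algebra K F] {P : Place K F} {A : Subalgebra K F}

/-- `u` lies in `A` and has a nonzero value at `P`. -/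
def IsUnitIn (P : Place K F) (A : Subalgebra K F) (u : F) : Prop :=
  u ∈ A ∧ ∃ c ≠ 0, P.HasValue u c

/-- `A` contains the inverse of each of its elements which is a unit at `P`. -/
def IsInvClosed (P : Place K F) (A : Subalgebra K F) : Prop :=
  ∀ a ∈ A, ∀ c ≠ 0, P.HasValue a c → a⁻¹ ∈ A

/-- `z` is a power of `t` times an element of `A` that is a unit at `P`. -/
def Factors (P : Place K F) (A : Subalgebra K F) (t z : F) : Prop :=
  ∃ k : ℤ, ∃ u, P.IsUnitIn A u ∧ z = t ^ k * u

variable {t u v z w : F}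

theorem IsUnitIn.ne_zero (hu : P.IsUnitIn A u) : u ≠ 0 := by
  obtain ⟨_, c, hc, h⟩ := hu
  exact h.ne_zero hc

theorem IsUnitIn.mul (hu : P.IsUnitIn A u) (hv : P.IsUnitIn A v) : P.IsUnitIn A (u * v) := by
  obtain ⟨hu, c, hc, h⟩ := hu
  obtain ⟨hv, d, hd, h'⟩ := hv
  exact ⟨mul_mem hu hv, c * d, mul_ne_zero hc hd, h.mul h'⟩

theorem IsUnitIn.pow (hu : P.IsUnitIn A u) (k : ℕ) : P.IsUnitIn A (u ^ k) := by
  obtain ⟨hu, c, hc, h⟩ := hu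
  exact ⟨pow_mem hu k, c ^ k, pow_ne_zero k hc, h.pow k⟩

theorem IsUnitIn.inv (hA : P.IsInvClosed A) (hu : P.IsUnitIn A u) : P.IsUnitIn A u⁻¹ := by
  obtain ⟨hu, c, hc, h⟩ := hu
  exact ⟨hA u hu c hc h, c⁻¹, inv_ne_zero hc, h.inv hc⟩

theorem IsUnitIn.add (hu : P.IsUnitIn A u) (hv : v ∈ A) (h : P.HasValue v 0) :
    P.IsUnitIn A (u + v) := by
  obtain ⟨hu, c, hc, h'⟩ := hu
  exact ⟨add_mem hu hv, c, hc, by simpa using h'.add h⟩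

theorem Factors.mul (ht : t ≠ 0) (hz : P.Factors A t z) (hw : P.Factors A t w) :
    P.Factors A t (z * w) := by
  obtain ⟨k, u, hu, rfl⟩ := hz
  obtain ⟨m, v, hv, rfl⟩ := hw
  exact ⟨k + m, u * v, hu.mul hv, by rw [zpow_add₀ ht]; ring⟩

theorem Factors.inv (hA : P.IsInvClosed A) (hz : P.Factors A t z) :
    P.Factors A t z⁻¹ := by
  obtain ⟨k, u, hu, rfl⟩ := hz
  exact ⟨-k, u⁻¹, hu.inv hA, by rw [mul_inv, zpow_neg]⟩

/-- Pulling out the lower power leaves a unit plus an element vanishing at `P`, again a unit. -/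
theorem factors_add_of_lt (htA : t ∈ A) (ht : P.HasValue t 0) (ht0 : t ≠ 0) {k m : ℤ}
    (hkm : k < m) (hu : P.IsUnitIn A u) (hv : P.IsUnitIn A v) :
    P.Factors A t (t ^ k * u + t ^ m * v) := by
  obtain ⟨l, hl⟩ : ∃ l : ℕ, m = k + (l + 1 : ℕ) := ⟨(m - k - 1).toNat, by omega⟩
  refine ⟨k, u + t ^ (l + 1) * v, hu.add (mul_mem (pow_mem htA _) hv.1) ?_, ?_⟩
  · obtain ⟨_, d, _, h⟩ := hv
    simpa using (ht.pow (l + 1)).mul h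
  · rw [hl, zpow_add₀ ht0, zpow_natCast]
    ring

theorem factors_add_of_ne (htA : t ∈ A) (ht : P.HasValue t 0) (ht0 : t ≠ 0) {k m : ℤ}
    (hkm : k ≠ m) (hu : P.IsUnitIn A u) (hv : P.IsUnitIn A v) :
    P.Factors A t (t ^ k * u + t ^ m * v) := by
  rcases hkm.lt_or_gt with h | h
  · exact factors_add_of_lt htA ht ht0 h hu hv
  · rw [add_comm]
    exact factors_add_of_lt htA ht ht0 h hv hu

theorem aeval_mem_subalgebra {x : F} (hx : x ∈ A) (p : K[X]) : aeval x p ∈ A := by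
  have := (aeval (⟨x, hx⟩ : A) p).2
  rwa [← Subalgebra.coe_val, ← aeval_algHom_apply] at this

theorem exists_aeval_eq_pow_mul {x : F} {α : K} (hx : x ∈ A) (h : P.HasValue x α) {p : K[X]}
    (hp : p ≠ 0) :
    ∃ k : ℕ, ∃ u, P.IsUnitIn A u ∧ aeval x p = (x - algebraMap K F α) ^ k * u := by
  obtain ⟨q, hq, hd⟩ := exists_eq_pow_rootMultiplicity_mul_and_not_dvd p hp α
  refine ⟨p.rootMultiplicity α, aeval x q, ⟨aeval_mem_subalgebra hx q, q.eval α, ?_, h.aeval q⟩, ?_⟩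
  · rwa [Ne, ← IsRoot.def, ← dvd_iff_isRoot]
  · conv_lhs => rw [hq]
    simp

theorem mem_of_factors (ht : P.HasValue t 0) (ht0 : t ≠ 0) (htA : t ∈ A)
    (hz : z ∈ P.ring) (h : P.Factors A t z) : z ∈ A := by
  obtain ⟨k, u, hu, rfl⟩ := h
  rcases le_or_gt 0 k with hk | hk
  · lift k to ℕ using hk
    rw [zpow_natCast]
    exact mul_mem (pow_mem htA k) hu.1
  · exfalso
    apply ht.inv_not_mem ht0
    obtain ⟨l, rfl⟩ : ∃ l : ℕ, k = -(l + 1 : ℕ) := ⟨(-k - 1).toNat, by omega⟩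
    have hu0 := hu.ne_zero
    obtain ⟨_, c, hc, huc⟩ := hu
    have := mul_mem (mul_mem hz (huc.inv_mem hc)) (pow_mem ht.mem l)
    -- For `z = t ^ (-(l + 1)) * u` in the valuation ring, `z * u⁻¹ * t ^ l` is `t⁻¹`, which is not
    -- regular.
    rw [zpow_neg, zpow_natCast] at this
    convert this using 1
    field_simp
    ring

end Place

/-! ### Parameters on the curve, and places as points. -/

namespace IsHyperelliptic

variable {K F : Type*} [Field K] [Field F] [Algebra K F] {f : K[X]} {x y : F}
  {P : Place K F} {A : Subalgebra K F} {α β : K}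

theorem sub_ne_zero (h : IsHyperelliptic f x y) (α : K) : x - algebraMap K F α ≠ 0 := by
  simpa using h.aeval_ne_zero (X_sub_C_ne_zero α)

theorem y_ne_zero (h : IsHyperelliptic f x y) : y ≠ 0 := by
  rintro rfl
  have h1 : f ≠ 0 := by
    rintro rfl
    simpa using h.five_le_natDegree
  apply h.aeval_ne_zero h1
  rw [← h.sq_eq]
  simp

theorem eval_eq_sq (h : IsHyperelliptic f x y) (hx : P.HasValue x α) (hy : P.HasValue y β) :
    f.eval α = β ^ 2 := by
  have := hx.aeval f
  rw [← h.sq_eq] at this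
  exact this.unique (hy.pow 2)

/-- It suffices to factor the elements of `K[x, y]`. -/
theorem factors_of_forall (h : IsHyperelliptic f x y) (hA : P.IsInvClosed A) {t : F} (ht0 : t ≠ 0)
    (hpoly : ∀ p : K[X], p ≠ 0 → P.Factors A t (aeval x p)) (hy : P.Factors A t y)
    (hadd : ∀ p q : K[X], p ≠ 0 → q ≠ 0 → aeval x p + aeval x q * y ≠ 0 →
      P.Factors A t (aeval x p + aeval x q * y)) {z : F} (hz : z ≠ 0) : P.Factors A t z := by
  obtain ⟨p, q, r, hr, rfl⟩ := h.exists_eq_div z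
  have h0 : aeval x p + aeval x q * y ≠ 0 := by
    intro h0
    simp [h0] at hz
  rw [div_eq_mul_inv]
  refine Place.Factors.mul ht0 ?_ ((hpoly r hr).inv hA)
  by_cases hp : p = 0
  · have hq : q ≠ 0 := by
      rintro rfl
      simp [hp] at h0
    rw [hp, map_zero, zero_add]
    exact (hpoly q hq).mul ht0 hy
  by_cases hq : q = 0
  · rw [hq, map_zero, zero_mul, add_zero]
    exact hpoly p hp
  exact hadd p q hp hq h0

/-- Only cancellation in `p + q y` is at issue, when `p` and `q` have equal order. Then the
conjugate `p - q y` does not cancel, and the product of the two is a polynomial in `x`, already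
factored. -/
theorem factors_x_sub (h : IsHyperelliptic f x y) (h2 : (2 : K) ≠ 0) (hA : P.IsInvClosed A)
    (hxA : x ∈ A) (hyA : y ∈ A) (hx : P.HasValue x α) (hy : P.HasValue y β) (hβ : β ≠ 0)
    {z : F} (hz : z ≠ 0) : P.Factors A (x - algebraMap K F α) z := by
  have ht0 := h.sub_ne_zero α
  have htA : x - algebraMap K F α ∈ A := sub_mem hxA (A.algebraMap_mem α)
  have ht : P.HasValue (x - algebraMap K F α) 0 := by
    simpa using hx.sub (P.hasValue_algebraMap α)
  have hpoly : ∀ p : K[X], p ≠ 0 → P.Factors A (x - algebraMap K F α) (aeval x p) := by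
    intro p hp
    obtain ⟨k, u, hu, e⟩ := Place.exists_aeval_eq_pow_mul hxA hx hp
    exact ⟨k, u, hu, by rw [e, zpow_natCast]⟩
  have hyU : P.IsUnitIn A y := ⟨hyA, β, hβ, hy⟩
  refine h.factors_of_forall hA ht0 hpoly ⟨0, y, hyU, by simp⟩ ?_ hz
  intro p q hp hq h0
  have hnorm := hpoly _ (h.norm_ne_zero h0)
  rw [h.aeval_norm] at hnorm
  obtain ⟨k, u, hu, hpu⟩ := hpoly p hp
  obtain ⟨m, v, hv, hqv⟩ := hpoly q hq
  by_cases hkm : k = m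
  · subst hkm
    rw [hpu, hqv] at hnorm ⊢
    have huv : u + v * y ∈ A := add_mem hu.1 (mul_mem hv.1 hyA)
    have huv' : u - v * y ∈ A := sub_mem hu.1 (mul_mem hv.1 hyA)
    obtain ⟨_, c, hc, huc⟩ := hu
    obtain ⟨_, d, hd, hvd⟩ := hv
    by_cases hs : c + d * β = 0
    · have hU : P.IsUnitIn A (u - v * y) := by
        refine ⟨huv', c - d * β, ?_, huc.sub (hvd.mul hy)⟩
        -- In odd characteristic `c + d β` and `c - d β` cannot both vanish, since `c ≠ 0`.
        have : c - d * β = 2 * c := by linear_combination -hs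
        rw [this]
        exact mul_ne_zero h2 hc
      have h3 : P.Factors A (x - algebraMap K F α)
          ((x - algebraMap K F α) ^ k * u - (x - algebraMap K F α) ^ k * v * y) :=
        ⟨k, _, hU, by ring⟩
      have h4 := hnorm.mul ht0 (h3.inv hA)
      obtain ⟨_, _, hu1, e1⟩ := h3
      rwa [mul_inv_cancel_right₀] at h4
      rw [e1]
      exact mul_ne_zero (zpow_ne_zero _ ht0) hu1.ne_zero
    · exact ⟨k, u + v * y, ⟨huv, _, hs, huc.add (hvd.mul hy)⟩, by ring⟩
  · rw [hpu, hqv, mul_assoc]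
    exact Place.factors_add_of_ne htA ht ht0 hkm hu (hv.mul hyU)

/-- Here `α` is a simple root of the square-free `f`, so `x - α` is `y ^ 2` times a unit.
Polynomials in `x` thus have even order in `y`, and the orders of `p` and `q y` differ in parity, so
nothing cancels. -/
theorem factors_y (h : IsHyperelliptic f x y) (hA : P.IsInvClosed A)
    (hxA : x ∈ A) (hyA : y ∈ A) (hx : P.HasValue x α) (hy : P.HasValue y 0)
    {z : F} (hz : z ≠ 0) : P.Factors A y z := by
  have hy0 := h.y_ne_zero
  have hroot : f.IsRoot α := by
    rw [IsRoot.def, h.eval_eq_sq hx hy]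
    simp
  obtain ⟨g, hg⟩ := dvd_iff_isRoot.2 hroot
  have hgα : g.eval α ≠ 0 := by
    intro h0
    obtain ⟨g', hg'⟩ := dvd_iff_isRoot.2 (IsRoot.def.2 h0)
    refine not_isUnit_X_sub_C α (h.squarefree (X - C α) ⟨g', ?_⟩)
    rw [hg, hg']
    ring
  have hgU : P.IsUnitIn A (aeval x g) :=
    ⟨Place.aeval_mem_subalgebra hxA g, _, hgα, hx.aeval g⟩
  have hsub : x - algebraMap K F α = y ^ 2 * (aeval x g)⁻¹ := by
    rw [eq_mul_inv_iff_mul_eq₀ hgU.ne_zero, h.sq_eq, hg]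
    simp
  have hpoly : ∀ p : K[X], p ≠ 0 → ∃ k : ℕ, ∃ u, P.IsUnitIn A u ∧
      aeval x p = y ^ (2 * (k : ℤ)) * u := by
    intro p hp
    obtain ⟨k, u, hu, e⟩ := Place.exists_aeval_eq_pow_mul hxA hx hp
    refine ⟨k, (aeval x g)⁻¹ ^ k * u, ((hgU.inv hA).pow k).mul hu, ?_⟩
    rw [e, hsub, mul_pow, ← pow_mul, mul_assoc]
    norm_cast
  have h1 : P.IsUnitIn A 1 := ⟨one_mem A, 1, one_ne_zero, P.hasValue_one⟩
  refine h.factors_of_forall hA hy0 (fun p hp => ?_) ⟨1, 1, h1, by simp⟩ ?_ hz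
  · obtain ⟨k, u, hu, e⟩ := hpoly p hp
    exact ⟨_, u, hu, e⟩
  · intro p q hp hq _
    obtain ⟨k, u, hu, hpu⟩ := hpoly p hp
    obtain ⟨m, v, hv, hqv⟩ := hpoly q hq
    have e : aeval x q * y = y ^ (2 * (m : ℤ) + 1) * v := by
      rw [hqv, zpow_add_one₀ hy0]
      ring
    rw [hpu, e]
    exact Place.factors_add_of_ne hyA hy hy0 (by omega) hu hv

/-- The valuation ring of a place where `x` and `y` have values in `K` lies in every subalgebra
that contains `x`, `y` and the inverses of its elements with a nonzero value at the place. -/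
theorem mem_of_isInvClosed (h : IsHyperelliptic f x y) (h2 : (2 : K) ≠ 0) (hA : P.IsInvClosed A)
    (hxA : x ∈ A) (hyA : y ∈ A) (hx : P.HasValue x α) (hy : P.HasValue y β)
    {z : F} (hz : z ∈ P.ring) : z ∈ A := by
  rcases eq_or_ne z 0 with rfl | hz0
  · exact zero_mem A
  by_cases hβ : β = 0
  · subst hβ
    exact Place.mem_of_factors hy h.y_ne_zero hyA hz (h.factors_y hA hxA hyA hx hy hz0)
  · refine Place.mem_of_factors ?_ (h.sub_ne_zero α) (sub_mem hxA (A.algebraMap_mem α)) hz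
      (h.factors_x_sub h2 hA hxA hyA hx hy hβ hz0)
    simpa using hx.sub (P.hasValue_algebraMap α)

theorem ring_le_ring (h : IsHyperelliptic f x y) (h2 : (2 : K) ≠ 0) {Q : Place K F}
    (hx : P.HasValue x α) (hy : P.HasValue y β) (hx' : Q.HasValue x α) (hy' : Q.HasValue y β) :
    P.ring ≤ Q.ring := by
  -- The functions that take the same value in `K` at `P` and at `Q`.
  let A : Subalgebra K F :=
    { carrier := {z | ∃ c, P.HasValue z c ∧ Q.HasValue z c}
      mul_mem' := fun ⟨_, h1, h2⟩ ⟨_, h3, h4⟩ => ⟨_, h1.mul h3, h2.mul h4⟩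
      add_mem' := fun ⟨_, h1, h2⟩ ⟨_, h3, h4⟩ => ⟨_, h1.add h3, h2.add h4⟩
      algebraMap_mem' := fun c => ⟨c, P.hasValue_algebraMap c, Q.hasValue_algebraMap c⟩ }
  have hA : P.IsInvClosed A := by
    rintro a ⟨c', h1, h2⟩ c hc h3
    obtain rfl := h1.unique h3
    exact ⟨_, h1.inv hc, h2.inv hc⟩
  intro z hz
  obtain ⟨_, _, hc⟩ := h.mem_of_isInvClosed h2 hA ⟨α, hx, hx'⟩ ⟨β, hy, hy'⟩ hx hy hz
  exact hc.mem

/-- A place is determined by the values of `x` and `y`. -/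
theorem place_eq (h : IsHyperelliptic f x y) (h2 : (2 : K) ≠ 0) {Q : Place K F}
    (hx : P.HasValue x α) (hy : P.HasValue y β) (hx' : Q.HasValue x α) (hy' : Q.HasValue y β) :
    P = Q :=
  Place.ext (le_antisymm (h.ring_le_ring h2 hx hy hx' hy') (h.ring_le_ring h2 hx' hy' hx hy))

end IsHyperelliptic

/-! ### Prime elements, expansions and residues. -/

namespace Place

variable {K F : Type*} [Field K] [Field F] [Algebra K F] {P : Place K F} {s t z w : F} {r : K}

/-- The valuation ring of a place as a subalgebra. -/
def subalgebra (P : Place K F) : Subalgebra K F :=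
  { P.ring.toSubring with algebraMap_mem' := P.algebraMap_mem }

theorem isInvClosed_subalgebra (P : Place K F) : P.IsInvClosed P.subalgebra :=
  fun _ _ _ hc h => h.inv_mem hc

theorem isPrimeElement_iff (ht0 : t ≠ 0) :
    P.IsPrimeElement t ↔ P.HasValue t 0 ∧ ∀ z, P.HasValue z 0 → z * t⁻¹ ∈ P.ring := by
  constructor
  · rintro ⟨ht, h⟩
    refine ⟨?_, fun z hz => ?_⟩
    · rw [hasValue_zero_iff ht, ← h]
      exact Ideal.mem_span_singleton_self _
    · have h1 := (hasValue_zero_iff hz.mem).1 hz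
      rw [← h, Ideal.mem_span_singleton] at h1
      obtain ⟨v, hv⟩ := h1
      have hv' : z = t * (v : F) := congrArg Subtype.val hv
      rw [hv', mul_comm t, mul_inv_cancel_right₀ ht0]
      exact v.2
  · rintro ⟨ht, h⟩
    refine ⟨ht.mem, le_antisymm ?_ fun z hz => ?_⟩
    · rw [Ideal.span_singleton_le_iff_mem]
      exact (hasValue_zero_iff ht.mem).1 ht
    · rw [Ideal.mem_span_singleton]
      refine ⟨⟨_, h z ((hasValue_zero_iff z.2).2 hz)⟩, Subtype.ext ?_⟩
      change (z : F) = t * (z * t⁻¹)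
      field_simp

theorem isPrimeElement_of_factors (ht : P.HasValue t 0) (ht0 : t ≠ 0)
    (h : ∀ z, z ≠ 0 → P.Factors P.subalgebra t z) : P.IsPrimeElement t := by
  refine (isPrimeElement_iff ht0).2 ⟨ht, fun z hz => ?_⟩
  rcases eq_or_ne z 0 with rfl | hz0
  · rw [zero_mul]
    exact zero_mem _
  obtain ⟨k, u, hu, rfl⟩ := h z hz0
  rcases le_or_gt k 0 with hk | hk
  -- With exponent `k ≤ 0` the inverse of `z` would be regular, although `z` vanishes at `P`.
  · exfalso
    obtain ⟨m, rfl⟩ : ∃ m : ℕ, k = -m := ⟨(-k).toNat, by omega⟩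
    apply hz.inv_not_mem hz0
    have hi := (hu.inv P.isInvClosed_subalgebra).1
    rw [zpow_neg, mul_inv, inv_inv, zpow_natCast]
    exact mul_mem (pow_mem ht.mem m) hi
  · obtain ⟨m, rfl⟩ : ∃ m : ℕ, k = (m + 1 : ℕ) := ⟨(k - 1).toNat, by omega⟩
    have : t ^ ((m + 1 : ℕ) : ℤ) * u * t⁻¹ = t ^ m * u := by
      rw [zpow_natCast]
      field_simp
      ring
    rw [this]
    exact mul_mem (pow_mem ht.mem m) hu.1

/-- The coefficients of the power series expansion of an element of the valuation ring. -/
theorem exists_remainders (hP : P.IsRational) (hs : P.IsPrimeElement s) (hs0 : s ≠ 0)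
    (hw : w ∈ P.ring) : ∃ (W : ℕ → F) (b : ℕ → K), W 0 = w ∧ (∀ k, P.HasValue (W k) (b k)) ∧
      ∀ k, W k = algebraMap K F (b k) + s * W (k + 1) := by
  have step : ∀ z : P.ring, ∃ c : K, ∃ z' : P.ring,
      P.HasValue (z : F) c ∧ (z : F) = algebraMap K F c + s * z' := by
    intro z
    obtain ⟨c, hc⟩ := hP.exists_hasValue z.2
    have h0 : P.HasValue (z - algebraMap K F c) 0 := by
      simpa using hc.sub (P.hasValue_algebraMap c)
    refine ⟨c, ⟨_, ((isPrimeElement_iff hs0).1 hs).2 _ h0⟩, hc, ?_⟩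
    change (z : F) = _ + s * ((z - algebraMap K F c) * s⁻¹)
    field_simp
    ring
  choose c next h1 h2 using step
  refine ⟨fun k => (next^[k] ⟨w, hw⟩ : P.ring), fun k => c (next^[k] ⟨w, hw⟩), rfl,
    fun k => h1 _, fun k => ?_⟩
  simp only [Function.iterate_succ_apply']
  exact h2 _

/-- A function with at most a simple pole has an expansion, beginning with the value of `s z`. -/
theorem exists_isExpansion (hP : P.IsRational) (hs : P.IsPrimeElement s) (hs0 : s ≠ 0)
    (hz : P.HasValue (s * z) r) : ∃ a : ℤ → K, P.IsExpansion s z a ∧ a (-1) = r := by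
  obtain ⟨W, b, hW0, hWb, hW⟩ := exists_remainders hP hs hs0 hz.mem
  have hb0 : b 0 = r := (hWb 0).unique (hW0 ▸ hz)
  -- The `b k` are the coefficients of `s * z`; dividing by `s` shifts the index by one, so `b 0`
  -- sits at index `-1`.
  refine ⟨fun i => if i < -1 then 0 else b (i + 1).toNat, ⟨-1, fun i hi => by simp [hi], ?_⟩,
    by simpa using hb0⟩
  have key : ∀ M : ℕ, z - ∑ i ∈ Finset.Ico (-1 : ℤ) (-1 + M),
      algebraMap K F (if i < -1 then 0 else b (i + 1).toNat) * s ^ i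
        = s ^ (-1 + M : ℤ) * W M := by
    intro M
    induction M with
    | zero =>
      rw [hW0]
      simp [inv_mul_cancel_left₀ hs0]
    | succ M ih =>
      have hM : (-1 + (M + 1 : ℕ) : ℤ) = -1 + M + 1 := by push_cast; ring
      rw [hM, ← Finset.insert_Ico_right_eq_Ico_add_one (by omega), Finset.sum_insert (by simp),
        add_comm, ← sub_sub, ih, hW M, if_neg (by omega), zpow_add_one₀ hs0]
      have : (-1 + (M : ℤ) + 1).toNat = M := by omega
      rw [this]
      ring
  intro N
  rcases le_or_gt N (-1) with hN | hN
  · obtain ⟨m, rfl⟩ : ∃ m : ℕ, N = -(m + 1 : ℕ) := ⟨(-N - 1).toNat, by omega⟩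
    rw [Finset.Ico_eq_empty (by omega), Finset.sum_empty, sub_zero, neg_neg, zpow_natCast, pow_succ']
    have := mul_mem hz.mem (pow_mem ((isPrimeElement_iff hs0).1 hs).1.mem m)
    convert this using 1
    ring
  · obtain ⟨M, rfl⟩ : ∃ M : ℕ, N = -1 + M := ⟨(N + 1).toNat, by omega⟩
    rw [key, mul_right_comm, ← zpow_add₀ hs0, add_neg_cancel, zpow_zero, one_mul]
    exact (hWb M).mem

theorem sum_Ico_eq_of_le {a : ℤ → K} {m n N : ℤ} (hmn : m ≤ n) (ha : ∀ i < n, a i = 0) :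
    ∑ i ∈ Finset.Ico n N, algebraMap K F (a i) * t ^ i
      = ∑ i ∈ Finset.Ico m N, algebraMap K F (a i) * t ^ i := by
  refine Finset.sum_subset (Finset.Ico_subset_Ico_left hmn) fun i hi hi' => ?_
  rw [Finset.mem_Ico] at hi hi'
  rw [ha i (by omega), map_zero, zero_mul]

theorem IsExpansion.unique {a a' : ℤ → K} (ht : P.HasValue t 0) (ht0 : t ≠ 0)
    (h : P.IsExpansion t z a) (h' : P.IsExpansion t z a') : a = a' := by
  obtain ⟨n, hn, h⟩ := h
  obtain ⟨n', hn', h'⟩ := h'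
  by_contra hne
  obtain ⟨j, hj⟩ := Function.ne_iff.1 hne
  set m := min n n' with hm
  have hmem : ∀ i, a i ≠ a' i → m ≤ i := by
    intro i hi
    by_contra hlt
    exact hi (by rw [hn i (by omega), hn' i (by omega)])
  obtain ⟨i, hi, hmin⟩ := Int.exists_least_of_bdd ⟨m, hmem⟩ ⟨j, hj⟩
  -- At the least index `i` of disagreement, truncation just after `i` leaves `(a i - a' i) * t⁻¹`
  -- in the valuation ring, which is impossible.
  have h1 := sub_mem (h' (i + 1)) (h (i + 1))
  rw [sum_Ico_eq_of_le (min_le_left n n') hn, ← hm] at h1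
  rw [sum_Ico_eq_of_le (min_le_right n n') hn', ← hm, ← sub_mul, sub_sub_sub_cancel_left,
    ← Finset.sum_sub_distrib, Finset.sum_eq_single i] at h1
  · have hd : algebraMap K F (a i - a' i) ≠ 0 := (_root_.map_ne_zero _).2 (sub_ne_zero.2 hi)
    apply ht.inv_not_mem ht0
    have h2 := mul_mem (P.algebraMap_mem (a i - a' i)⁻¹) h1
    rw [← sub_mul, ← map_sub, mul_assoc, ← zpow_add₀ ht0, ← mul_assoc, map_inv₀,
      inv_mul_cancel₀ hd, one_mul] at h2
    simpa using h2
  · intro l hl hli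
    rw [Finset.mem_Ico] at hl
    have : a l = a' l := by
      by_contra hla
      have := hmin l hla
      omega
    rw [this, sub_self]
  · intro hi'
    exact absurd (Finset.mem_Ico.2 ⟨hmem i hi, by omega⟩) hi'

theorem HasResidue.unique {ω : Ω[F⁄K]} {r' : K} (ht : P.IsPrimeElement t) (ht0 : t ≠ 0)
    (hD : KaehlerDifferential.D K F t ≠ 0) (h : P.HasResidue ω r) (h' : P.HasResidue ω r') :
    r = r' := by
  obtain ⟨z, hz, a, ha, rfl⟩ := h t ht
  obtain ⟨z', hz', a', ha', rfl⟩ := h' t ht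
  obtain rfl : z = z' := smul_left_injective F hD (hz.symm.trans hz')
  rw [ha.unique ((isPrimeElement_iff ht0).1 ht).1 ht0 ha']

theorem HasResidue.residue_eq {ω : Ω[F⁄K]} (ht : P.IsPrimeElement t) (ht0 : t ≠ 0)
    (hD : KaehlerDifferential.D K F t ≠ 0) (h : P.HasResidue ω r) : P.residue ω = r := by
  have hex : ∃ r, P.HasResidue ω r := ⟨r, h⟩
  rw [residue, dif_pos hex]
  exact HasResidue.unique ht ht0 hD hex.choose_spec h

/-- The residue at a simple pole, if the derivation `d/dt` preserves the valuation ring. -/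
theorem hasResidue_of_simple_pole (hP : P.IsRational) (ht : P.IsPrimeElement t) (ht0 : t ≠ 0)
    (hder : ∀ z ∈ P.ring, ∃ w ∈ P.ring,
      KaehlerDifferential.D K F z = w • KaehlerDifferential.D K F t)
    (hz : P.HasValue (t * z) r) : P.HasResidue (z • KaehlerDifferential.D K F t) r := by
  intro s hs
  have htv := (isPrimeElement_iff ht0).1 ht
  have hs0 : s ≠ 0 := by
    rintro rfl
    obtain ⟨h0, h⟩ := hs
    have h1 := (hasValue_zero_iff htv.1.mem).1 htv.1
    rw [← h, Ideal.mem_span_singleton] at h1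
    obtain ⟨v, hv⟩ := h1
    have hv' : t = 0 * (v : F) := congrArg Subtype.val hv
    rw [zero_mul] at hv'
    exact ht0 hv'
  have hsv := (isPrimeElement_iff hs0).1 hs
  set v := s * t⁻¹ with hv
  have hst : s = t * v := by rw [hv]; field_simp
  have hvm : v ∈ P.ring := htv.2 s hsv.1
  have hvi : v⁻¹ ∈ P.ring := by
    have := hsv.2 t htv.1
    rwa [hv, mul_inv, inv_inv, mul_comm]
  have hv0 : v ≠ 0 := mul_ne_zero hs0 (inv_ne_zero ht0)
  obtain ⟨c, hc⟩ := hP.exists_hasValue hvm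
  have hc0 : c ≠ 0 := by
    rintro rfl
    exact hc.inv_not_mem hv0 hvi
  obtain ⟨w, hw, hDv⟩ := hder v hvm
  obtain ⟨d, hd⟩ := hP.exists_hasValue hw
  -- For `s = t v` and `dv = w dt`, the factor `ds/dt = v + t w` has the same nonzero value as `v`.
  have he : P.HasValue (v + t * w) c := by simpa using hc.add (htv.1.mul hd)
  have hDs : KaehlerDifferential.D K F s = (v + t * w) • KaehlerDifferential.D K F t := by
    rw [hst, Derivation.leibniz, hDv, smul_smul, add_smul, add_comm]
  have he0 := he.ne_zero hc0
  -- This is `z dt/ds`; multiplied by `s` it equals `(t z) * v / (v + t w)`, whose value is that of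
  -- `t z`.
  refine ⟨z * (v + t * w)⁻¹, ?_, exists_isExpansion hP hs hs0 ?_⟩
  · rw [hDs, smul_smul, inv_mul_cancel_right₀ he0]
  · have := hz.mul (hc.mul (he.inv hc0))
    rw [mul_inv_cancel₀ hc0, mul_one] at this
    convert this using 1
    rw [hst]
    ring

end Place

/-! ### Differentials at points with `y ≠ 0`. -/

namespace IsHyperelliptic

variable {K F : Type*} [Field K] [Field F] [Algebra K F] {f : K[X]} {x y : F}
  {P : Place K F} {α β : K}

theorem isPrimeElement_x_sub (h : IsHyperelliptic f x y) (h2 : (2 : K) ≠ 0)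
    (hx : P.HasValue x α) (hy : P.HasValue y β) (hβ : β ≠ 0) :
    P.IsPrimeElement (x - algebraMap K F α) := by
  refine Place.isPrimeElement_of_factors ?_ (h.sub_ne_zero α)
    fun z hz => h.factors_x_sub h2 P.isInvClosed_subalgebra hx.mem hy.mem hx hy hβ hz
  simpa using hx.sub (P.hasValue_algebraMap α)

/-- From `2 y dy = f'(x) dx` and `β ≠ 0`, `dy` is a regular multiple of `dx`. The regular functions
with this property form a subalgebra closed under inverting units, by the Leibniz rule. -/
theorem exists_D_eq_smul (h : IsHyperelliptic f x y) (h2 : (2 : K) ≠ 0)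
    (hx : P.HasValue x α) (hy : P.HasValue y β) (hβ : β ≠ 0) {z : F} (hz : z ∈ P.ring) :
    ∃ w ∈ P.ring, KaehlerDifferential.D K F z = w • KaehlerDifferential.D K F x := by
  let A : Subalgebra K F :=
    { carrier := {z | z ∈ P.ring ∧
        ∃ w ∈ P.ring, KaehlerDifferential.D K F z = w • KaehlerDifferential.D K F x}
      mul_mem' := by
        rintro a b ⟨ha, v, hv, h1⟩ ⟨hb, w, hw, h3⟩
        refine ⟨mul_mem ha hb, a * w + b * v, add_mem (mul_mem ha hw) (mul_mem hb hv), ?_⟩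
        rw [Derivation.leibniz, h1, h3, smul_smul, smul_smul, add_smul]
      add_mem' := by
        rintro a b ⟨ha, v, hv, h1⟩ ⟨hb, w, hw, h3⟩
        refine ⟨add_mem ha hb, v + w, add_mem hv hw, ?_⟩
        rw [map_add, h1, h3, add_smul]
      algebraMap_mem' := fun c => ⟨P.algebraMap_mem c, 0, zero_mem _, by simp⟩ }
  have hA : P.IsInvClosed A := by
    rintro a ⟨ha, v, hv, h1⟩ c hc hac
    have hi := hac.inv_mem hc
    refine ⟨hi, -a⁻¹ ^ 2 * v, mul_mem (neg_mem (pow_mem hi 2)) hv, ?_⟩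
    rw [Derivation.leibniz_inv, h1, smul_smul]
  have h2y : P.HasValue (algebraMap K F 2 * y) (2 * β) := (P.hasValue_algebraMap 2).mul hy
  have h2β : 2 * β ≠ 0 := mul_ne_zero h2 hβ
  have hyA : y ∈ A := by
    refine ⟨hy.mem, (algebraMap K F 2 * y)⁻¹ * aeval x (derivative f),
      mul_mem (h2y.inv_mem h2β) (hx.aeval _).mem, ?_⟩
    rw [mul_smul, ← Derivation.map_aeval, ← h.sq_eq, pow_two, Derivation.leibniz, ← add_smul,
      smul_smul, ← two_mul, map_ofNat]
    have := h2y.ne_zero h2β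
    rw [map_ofNat] at this
    rw [inv_mul_cancel₀ this, one_smul]
  have hxA : x ∈ A := ⟨hx.mem, 1, one_mem _, (one_smul _ _).symm⟩
  exact (h.mem_of_isInvClosed h2 hA hxA hyA hx hy hz).2

/-- If `dx = 0`, then `2 y dy = 0` gives `dy = 0`, so all differentials vanish. The finitely
generated extension `F / K` would be unramified, hence separable algebraic, against the
transcendence of `x`. -/
theorem D_x_ne_zero [PerfectField K] (h : IsHyperelliptic f x y) (h2 : (2 : K) ≠ 0) :
    KaehlerDifferential.D K F x ≠ 0 := by
  intro hDx
  have hDy : KaehlerDifferential.D K F y = 0 := by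
    have h3 : KaehlerDifferential.D K F (y ^ 2) = 0 := by
      rw [h.sq_eq, Derivation.map_aeval, hDx, smul_zero]
    rw [pow_two, Derivation.leibniz, ← add_smul, ← two_mul, smul_eq_zero] at h3
    refine h3.resolve_left (mul_ne_zero ?_ h.y_ne_zero)
    rw [← map_ofNat (algebraMap K F) 2]
    exact (_root_.map_ne_zero _).2 h2
  have hD : ∀ z : F, KaehlerDifferential.D K F z = 0 := by
    intro z
    have hz : z ∈ IntermediateField.adjoin K {x, y} := by
      rw [h.adjoin_eq_top]; trivial
    induction hz using IntermediateField.adjoin_induction with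
    | mem z hz =>
      rcases hz with rfl | rfl
      · exact hDx
      · exact hDy
    | algebraMap c => simp
    | add z w _ _ hz hw => rw [map_add, hz, hw, add_zero]
    | mul z w _ _ hz hw => rw [Derivation.leibniz, hz, hw, smul_zero, smul_zero, add_zero]
    | inv z _ hz => rw [Derivation.leibniz_inv, hz, smul_zero]
  have hsub : Subsingleton Ω[F⁄K] := by
    rw [← Submodule.subsingleton_iff F, ← subsingleton_iff_bot_eq_top,
      ← KaehlerDifferential.span_range_derivation, eq_comm, Submodule.span_eq_bot]
    rintro _ ⟨z, rfl⟩
    exact hD z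
  have : Algebra.FormallyUnramified K F := (Algebra.formallyUnramified_iff K F).2 hsub
  have hfin : Algebra.EssFiniteType K F := IntermediateField.fg_top_iff.1
    (IntermediateField.fg_def.2 ⟨{x, y}, Set.toFinite _, h.adjoin_eq_top⟩)
  have hsep := (Algebra.FormallyUnramified.iff_isSeparable K F).1 this
  exact h.transcendental (hsep.isAlgebraic.isAlgebraic x)

end IsHyperelliptic

/-! ### Rational places, conjugation and the residue of `η`. -/

namespace Place

variable {K F : Type*} [Field K] [Field F] [Algebra K F] {P : Place K F}

theorem isRational_of_forall (h : ∀ z ∈ P.ring, ∃ c, P.HasValue z c) : P.IsRational := by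
  refine (finrank_eq_one_iff_of_nonzero' (K := K)
    (1 : IsLocalRing.ResidueField P.ring) one_ne_zero).2 fun w => ?_
  obtain ⟨z, rfl⟩ := IsLocalRing.residue_surjective w
  obtain ⟨c, _, hc⟩ := h z z.2
  exact ⟨c, by rw [← Algebra.algebraMap_eq_smul_one, ← hc]⟩

theorem IsRational.map (h : P.IsRational) (σ : F ≃ₐ[K] F) : (P.map σ).IsRational := by
  refine isRational_of_forall fun z hz => ?_
  obtain ⟨c, hc⟩ := h.exists_hasValue (mem_map.1 hz)
  exact ⟨c, by simpa using hc.map σ⟩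

theorem IsRational.exists_hasValue_of_sq (h : P.IsRational) {y : F} (hy : y ^ 2 ∈ P.ring) :
    ∃ β, P.HasValue y β := by
  refine h.exists_hasValue ?_
  rcases P.ring.mem_or_inv_mem y with h1 | h1
  · exact h1
  rcases eq_or_ne y 0 with rfl | hy0
  · exact zero_mem _
  -- If `y⁻¹` is regular, so is `y = y ^ 2 * y⁻¹`.
  have := mul_mem hy h1
  rwa [pow_two, mul_inv_cancel_right₀ hy0] at this

end Place

namespace IsHyperelliptic

variable {K F : Type*} [Field K] [Field F] [Algebra K F] {f : K[X]} {x y : F}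

theorem hasValue_conj_x (h : IsHyperelliptic f x y) {P : Place K F} {α : K}
    (hx : P.HasValue x α) : (P.map h.conj).HasValue x α := by
  simpa [h.conj_x] using hx.map h.conj

theorem hasValue_conj_y (h : IsHyperelliptic f x y) {P : Place K F} {β : K}
    (hy : P.HasValue y β) : (P.map h.conj).HasValue y (-β) := by
  simpa [h.conj_y] using (hy.map h.conj).neg

/-- The residue of `dx / (y * ∏ j, (x - α j))` at a rational place over `x = α i`, `y = β`. -/
theorem residue_eta [PerfectField K] (h : IsHyperelliptic f x y) (h2 : (2 : K) ≠ 0) {n : ℕ}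
    {α : Fin n → K} (hα : Function.Injective α) {P : Place K F} (hP : P.IsRational) {i : Fin n}
    {β : K} (hx : P.HasValue x (α i)) (hy : P.HasValue y β) (hβ : β ≠ 0) :
    P.HasResidue (eta x y α) (P.residue (eta x y α)) ∧
      P.residue (eta x y α) = (β * ∏ j ∈ Finset.univ.erase i, (α i - α j))⁻¹ := by
  set t := x - algebraMap K F (α i) with ht
  have ht0 : t ≠ 0 := h.sub_ne_zero (α i)
  have hprime : P.IsPrimeElement t := h.isPrimeElement_x_sub h2 hx hy hβ
  have hDt : KaehlerDifferential.D K F t = KaehlerDifferential.D K F x := by simp [ht]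
  have hden : P.HasValue (y * ∏ j ∈ Finset.univ.erase i, (x - algebraMap K F (α j)))
      (β * ∏ j ∈ Finset.univ.erase i, (α i - α j)) :=
    hy.mul (Place.HasValue.prod _ fun j _ => hx.sub (P.hasValue_algebraMap (α j)))
  have hc : β * ∏ j ∈ Finset.univ.erase i, (α i - α j) ≠ 0 := by
    refine mul_ne_zero hβ (Finset.prod_ne_zero_iff.2 fun j hj => ?_)
    exact _root_.sub_ne_zero.2 (hα.ne (Finset.ne_of_mem_erase hj).symm)
  have hval : P.HasValue (t * (1 / (y * ∏ j, (x - algebraMap K F (α j)))))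
      (β * ∏ j ∈ Finset.univ.erase i, (α i - α j))⁻¹ := by
    have hd0 := hden.ne_zero hc
    convert hden.inv hc using 1
    rw [← Finset.mul_prod_erase Finset.univ _ (Finset.mem_univ i), ← ht]
    field_simp
  have hres := Place.hasResidue_of_simple_pole hP hprime ht0
    (fun z hz => hDt ▸ h.exists_D_eq_smul h2 hx hy hβ hz) hval
  rw [hDt] at hres
  have hD0 : KaehlerDifferential.D K F t ≠ 0 := hDt ▸ h.D_x_ne_zero h2
  have heq := Place.HasResidue.residue_eq (ω := eta x y α) hprime ht0 hD0 hres
  exact ⟨heq.symm ▸ hres, heq⟩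

end IsHyperelliptic

end HyperellipticResidue

open HyperellipticResidue in
theorem mainTheorem5 {K F : Type*} [Field K] [Finite K] [Field F] [Algebra K F]
    (hchar : ringChar K ≠ 2)
    (f : Polynomial K) (x y : F) (hF : IsHyperelliptic f x y)
    (n : ℕ) (P : Fin n → Place K F) (α : Fin n → K)
    (hrat : ∀ i, (P i).IsRational)
    (hα : ∀ i, (P i).HasValue x (α i))
    (hinj : Function.Injective P)
    (hconj : ∀ i j, (P i).map hF.conj ≠ P j) :
    ∀ i, (P i).HasResidue (eta x y α) ((P i).residue (eta x y α)) ∧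
      ((P i).map hF.conj).HasResidue (eta x y α) (((P i).map hF.conj).residue (eta x y α)) ∧
      (P i).residue (eta x y α) = -((P i).map hF.conj).residue (eta x y α) := by
  have h2 : (2 : K) ≠ 0 := Ring.two_ne_zero hchar
  have hval : ∀ i, ∃ β, (P i).HasValue y β := fun i =>
    (hrat i).exists_hasValue_of_sq (hF.sq_eq ▸ ((hα i).aeval f).mem)
  choose β hβ using hval
  have hβ0 : ∀ i, β i ≠ 0 := by
    intro i h0
    have hy : (P i).HasValue y 0 := h0 ▸ hβ i
    refine hconj i i (hF.place_eq h2 (hF.hasValue_conj_x (hα i)) (hF.hasValue_conj_y hy) (hα i) ?_)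
    rwa [neg_zero]
  have hαinj : Function.Injective α := by
    intro i j hij
    have hsq : β i ^ 2 = β j ^ 2 := by
      rw [← hF.eval_eq_sq (hα i) (hβ i), ← hF.eval_eq_sq (hα j) (hβ j), hij]
    -- Over a common `x`-coordinate, equal `y`-values make the places equal, and opposite values
    -- make them conjugate.
    rcases sq_eq_sq_iff_eq_or_eq_neg.1 hsq with h | h
    · exact hinj (hF.place_eq h2 (hα i) (hβ i) (hij ▸ hα j) (h ▸ hβ j))
    · refine absurd ?_ (hconj j i)
      exact hF.place_eq h2 (hF.hasValue_conj_x (hα j)) (hF.hasValue_conj_y (hβ j))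
        (hij ▸ hα i) (h ▸ hβ i)
  intro i
  obtain ⟨h1, e1⟩ := hF.residue_eta h2 hαinj (hrat i) (hα i) (hβ i) (hβ0 i)
  obtain ⟨h3, e3⟩ := hF.residue_eta h2 hαinj ((hrat i).map hF.conj)
    (hF.hasValue_conj_x (hα i)) (hF.hasValue_conj_y (hβ i)) (neg_ne_zero.2 (hβ0 i))
  refine ⟨h1, h3, ?_⟩
  rw [e1, e3, neg_mul, inv_neg, neg_neg]
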